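/- For a matroid $M$ on a finite set $E$ let $\mathcal I(M)$ be its independence complex, $\mathcal B(M)$ its set of bases, and $P_M=\operatorname{conv}\{\chi_B : B\in\mathcal B(M)\}\subset\mathbb R^E$ its matroid polytope. Let $P_M^*$ be the dual polytope, realized as the polar of $P_M-c$ in its linear span for a point $c$ in the relative interior of $P_M$. The facets of $P_M^*$ correspond to the vertices $\chi_B$ of $P_M$, so every total order $<$ of $\mathcal B(M)$ induces an order $<_\bullet$ of the facets of $P_M^*$. A shelling order of a pure simplicial complex $\Delta$ is a total order $F_1,\dots,F_k$ of its facets such that for each $j\ge 2$ the complex $\langle F_1,\dots,F_{j-1}\rangle\cap\langle F_j\rangle$ is pure of dimension $\dim\Delta-1$. It is reversible if the opposite order is also a shelling order. A shelling order of a polytope of dimension at least $2$ is a total order $F_1,\dots,F_k$ of its facets such that for each $j\ge 2$ one has $F_j\cap\bigcup_{i<j}F_i=G_1\cup\dots\cup G_r$ for some shelling order $G_1,\dots,G_t$ of $F_j$ and some $1\le r\le t$; in dimension at most $1$ every order of the facets is a shelling order. **Proposition.** There exist a matroid $M$ and a shelling order $<$ of $\mathcal I(M)$ such that $<_\bullet$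 is not a shelling order of $P_M^*$ (for any choice of $c$). Moreover, $M$ and $<$ can be chosen as follows: the ground set $E$ is totally ordered, $M$ has three distinct, pairwise disjoint bases $B,B',B''$ with $B$ the lexicographically smallest basis, the lexicographic order of $\mathcal B(M)$ is a shelling order of $\mathcal I(M)$, and $<$ is obtained from it by moving $B'$ and $B''$ (in this order) to the end; this $<$ is a shelling order of $\mathcal I(M)$ that is not reversible. -/

import Mathlib

noncomputable section

/-! ### Simplicial complexes and their shelling orders

A simplicial complex on a vertex set `α` is given by its set of faces; the empty face, of
dimension `-1`, is a face of every complex. -/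

/-- A nonempty family of finite sets closed under taking subsets. -/
def IsComplex {α : Type*} (Δ : Set (Finset α)) : Prop :=
  Δ.Nonempty ∧ ∀ F ∈ Δ, ∀ G, G ⊆ F → G ∈ Δ

/-- The facets of a complex: its inclusion-maximal faces. -/
def complexFacets {α : Type*} (Δ : Set (Finset α)) : Set (Finset α) :=
  {F | Maximal (fun G => G ∈ Δ) F}

/-- The complex `⟨𝒢⟩` generated by a family `𝒢`: all subsets of members of `𝒢`. -/
def generatedComplex {α : Type*} (𝒢 : Set (Finset α)) : Set (Finset α) :=
  {F | ∃ G ∈ 𝒢, F ⊆ G}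

/-- `Δ` is a pure simplicial complex of dimension `d`: all its facets have dimension `d`, where
the dimension of a face is its number of elements minus one. -/
def IsPureOfDim {α : Type*} (Δ : Set (Finset α)) (d : ℤ) : Prop :=
  IsComplex Δ ∧ ∀ F ∈ complexFacets Δ, (F.card : ℤ) - 1 = d

/-- The list `L = [F₁, …, F_k]` is a shelling order of the pure simplicial complex `Δ`: it lists
every facet exactly once, and for every facet `F` in the list other than the first one,
`⟨facets before F⟩ ∩ ⟨F⟩` is pure of dimension `dim Δ - 1`. Positions are counted from `0`. -/
def IsShellingOrder {α : Type*} (Δ : Set (Finset α)) (L : List (Finset α)) : Prop :=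
  L.Nodup ∧ (∀ F, F ∈ L ↔ F ∈ complexFacets Δ) ∧
    ∃ d : ℤ, IsPureOfDim Δ d ∧
      ∀ (j : ℕ) (hj : j < L.length), 0 < j →
        IsPureOfDim
          (generatedComplex {F | F ∈ L.take j} ∩ generatedComplex {L[j]}) (d - 1)

/-! ### Polytopes and their shelling orders -/

open Classical in
/-- The dimension of a subset of a real vector space, i.e. that of its affine span;
the empty set has dimension `-1`. -/
def polyDim {V : Type*} [AddCommGroup V] [Module ℝ V] (P : Set V) : ℤ :=
  if P.Nonempty then (Module.finrank ℝ (vectorSpan ℝ P) : ℤ) else -1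

/-- `F` is a facet of the polytope `P`: a face (a set where a linear functional attains its
maximum on `P`, or the empty face) of dimension one less than `P`. -/
def IsPolytopeFacet {V : Type*} [AddCommGroup V] [Module ℝ V] [TopologicalSpace V]
    (P F : Set V) : Prop :=
  IsExposed ℝ P F ∧ polyDim F + 1 = polyDim P

/-- The list `L` contains every facet of `P` exactly once. -/
def ListsPolytopeFacets {V : Type*} [AddCommGroup V] [Module ℝ V] [TopologicalSpace V]
    (P : Set V) (L : List (Set V)) : Prop :=
  L.Nodup ∧ ∀ F, F ∈ L ↔ IsPolytopeFacet P F

/-- Shelling orders of (the boundary of) a polytope `P` of dimension `n`, by recursion on `n`.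
If `n ≤ 1`, every order of the facets is one. If `n ≥ 2`, the intersection of every facet `F_j`
other than the first with the union of the previous facets has to be `G₁ ∪ ⋯ ∪ G_r` for some
shelling order `G₁, …, G_t` of `F_j` and some `1 ≤ r ≤ t`. For polygons (`n = 2`) this says
that every edge but the first shares a vertex with a previous edge. -/
def IsPolytopeShellingOfDim {V : Type*} [AddCommGroup V] [Module ℝ V] [TopologicalSpace V] :
    ℕ → Set V → List (Set V) → Prop
  | 0, P, L => ListsPolytopeFacets P L
  | 1, P, L => ListsPolytopeFacets P L
  | n + 2, P, L => ListsPolytopeFacets P L ∧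
      ∀ (j : ℕ) (hj : j < L.length), 0 < j →
        ∃ G : List (Set V), IsPolytopeShellingOfDim (n + 1) L[j] G ∧
          ∃ r : ℕ, 1 ≤ r ∧ r ≤ G.length ∧
            L[j] ∩ (⋃ F ∈ L.take j, F) = ⋃ F ∈ G.take r, F

/-- The list `L` is a shelling order of the polytope `P`. -/
def IsPolytopeShelling {V : Type*} [AddCommGroup V] [Module ℝ V] [TopologicalSpace V]
    (P : Set V) (L : List (Set V)) : Prop :=
  IsPolytopeShellingOfDim (polyDim P).toNat P L

/-- The dual (polar) polytope of a polytope `P ⊆ ℝ^E` with respect to a point `c` of its relative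
interior: `c` is moved to the origin, and the polar is taken inside the linear span of `P - c`. -/
def dualPolytope {E : Type*} [Fintype E] (P : Set (E → ℝ)) (c : E → ℝ) : Set (E → ℝ) :=
  {y | y ∈ vectorSpan ℝ P ∧ ∀ x ∈ P, dotProduct y (x - c) ≤ 1}

/-- The facet of the dual polytope of `P` that corresponds to the vertex `v` of `P`. -/
def dualFacet {E : Type*} [Fintype E] (P : Set (E → ℝ)) (c v : E → ℝ) : Set (E → ℝ) :=
  {y ∈ dualPolytope P c | dotProduct y (v - c) = 1}

/-! ### Matroids -/

/-- The independence complex `𝓘(M)`. -/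
def independenceComplex {E : Type*} (M : Matroid E) : Set (Finset E) :=
  {I | M.Indep (I : Set E)}

/-- The characteristic vector of a subset of `E`. -/
def charVec {E : Type*} (S : Finset E) : E → ℝ := Set.indicator (S : Set E) 1

/-- The matroid polytope `P_M`: the convex hull of the characteristic vectors of the bases. -/
def matroidPolytope {E : Type*} (M : Matroid E) : Set (E → ℝ) :=
  convexHull ℝ {x | ∃ B : Finset E, M.IsBase (B : Set E) ∧ x = charVec B}

/-- There are points in the relative interior of `P_M`, so that `P_M` has a dual polytope. -/
theorem matroidPolytope_intrinsicInterior_nonempty {E : Type*} [Fintype E] (M : Matroid E) :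
    (intrinsicInterior ℝ (matroidPolytope M)).Nonempty := by
  refine Set.Nonempty.intrinsicInterior (convex_convexHull ℝ _) ?_
  obtain ⟨B, hB⟩ := M.exists_isBase
  refine Set.Nonempty.mono (subset_convexHull ℝ _) ⟨charVec B.toFinite.toFinset, _, ?_, rfl⟩
  simpa using hB

/-- The order `<_•` of the facets of the dual matroid polytope (with respect to the point `c`)
that is induced by the order `L` of the bases. -/
def inducedFacetOrder {E : Type*} [Fintype E] (M : Matroid E) (c : E → ℝ)
    (L : List (Finset E)) : List (Set (E → ℝ)) :=
  L.map (fun B => dualFacet (matroidPolytope M) c (charVec B))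

/-- `L` is the list of all bases of `M` in lexicographic order: bases are compared as words, with
their elements written in increasing order. -/
def IsLexBasisList {E : Type*} [LinearOrder E] (M : Matroid E) (L : List (Finset E)) : Prop :=
  (∀ B : Finset E, B ∈ L ↔ M.IsBase (B : Set E)) ∧
    L.Pairwise (fun B C => B.sort < C.sort)

end

/-! ### Shelling orders of pure complexes of dimension one -/

/-! The example is `twoTriples`, the sum of two copies of the uniform matroid of rank one on three
elements. Its independence complex is the graph `K_{3,3}`, where an order of the edges is a shelling
as soon as every edge but the first meets an earlier one (`isShellingOrder_of_card_two`). Two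
disjoint edges cannot open a shelling (`not_isShellingOrder_of_disjoint`), so ending with `{1, 4}`,
`{2, 5}` destroys reversibility.

The polytope is a product of two triangles. Its dual is simplicial with six vertices, one for each
element `k`, and the facet of a basis `B` is the tetrahedron on the vertices `k ∉ B`. Moving `{1,
4}` behind `{2, 4}` leaves the edge between vertices `0` and `3` covered too thinly: of the six
bases before `{2, 4}`, only `{1, 5}` avoids both `0` and `3`. In a shelling, the midpoint of that
edge would lie in a two-dimensional face of the facet of `{2, 4}` covered by earlier facets.
Convexity forces that whole face into the facet of `{1, 5}`, but the two facets share only the edge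
(`polyDim_le_one_of_subset_inter`). -/

lemma complexFacets_independenceComplex {E : Type*} [Finite E] (M : Matroid E) (F : Finset E) :
    F ∈ complexFacets (independenceComplex M) ↔ M.IsBase (F : Set E) := by
  rw [Matroid.isBase_iff_maximal_indep]
  refine ⟨fun h => ⟨h.1, fun G hG hFG => ?_⟩, fun h => ⟨h.1, fun G hG hFG => ?_⟩⟩
  · have h2 := h.2 (y := G.toFinite.toFinset) (by simpa [independenceComplex] using hG)
      (by intro x hx; simpa using hFG hx)
    intro x hx
    exact h2 (by simpa using hx)
  · exact Finset.coe_subset.1 (h.2 (y := (G : Set E)) hG (Finset.coe_subset.2 hFG))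

lemma isComplex_independenceComplex {E : Type*} (M : Matroid E) :
    IsComplex (independenceComplex M) :=
  ⟨⟨∅, by simp [independenceComplex]⟩,
    fun _ hF _ hGF => Matroid.Indep.subset hF (Finset.coe_subset.2 hGF)⟩

lemma isComplex_generatedComplex_inter {α : Type*} {𝒢 : Set (Finset α)} {G F : Finset α}
    (hG : G ∈ 𝒢) : IsComplex (generatedComplex 𝒢 ∩ generatedComplex {F}) :=
  ⟨⟨∅, ⟨G, hG, by simp⟩, ⟨F, rfl, by simp⟩⟩,
    fun _ ⟨⟨A, hA, h1⟩, ⟨C, hC, h2⟩⟩ _ h => ⟨⟨A, hA, h.trans h1⟩, ⟨C, hC, h.trans h2⟩⟩⟩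

/-- An edge that shares a vertex with a family of other edges meets it in a complex that is pure
of dimension zero. -/
lemma isPureOfDim_zero_of_edge {α : Type*} [DecidableEq α] {𝒢 : Set (Finset α)} {F : Finset α}
    (hF : F.card = 2) (h𝒢 : ∀ G ∈ 𝒢, G.card = 2) (hnot : F ∉ 𝒢)
    (hmeet : ∃ G ∈ 𝒢, ¬ Disjoint G F) :
    IsPureOfDim (generatedComplex 𝒢 ∩ generatedComplex {F}) 0 := by
  obtain ⟨G, hG, hGF⟩ := hmeet
  obtain ⟨x, hxG, hxF⟩ := Finset.not_disjoint_iff.1 hGF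
  refine ⟨isComplex_generatedComplex_inter hG, ?_⟩
  rintro S ⟨⟨⟨A, hA, hSA⟩, ⟨C, rfl, hSF⟩⟩, hmax⟩
  have hne : S ≠ ∅ := by
    rintro rfl
    have := hmax (y := {x}) ⟨⟨G, hG, by simpa⟩, ⟨_, rfl, by simpa⟩⟩ (by simp)
    simpa using this (Finset.mem_singleton_self x)
  have hpos : 0 < S.card := Finset.card_pos.2 (Finset.nonempty_iff_ne_empty.2 hne)
  have hlt : S.card < 2 := by
    by_contra! h
    have h1 := Finset.eq_of_subset_of_card_le hSF (by omega)
    have h2 := Finset.eq_of_subset_of_card_le hSA (by rw [h𝒢 A hA]; exact h)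
    exact hnot (by rw [← h1, h2]; exact hA)
  omega

/-- For a matroid of rank two, an order of the bases in which every basis but the first meets a
previous one is a shelling order. -/
lemma isShellingOrder_of_card_two {E : Type*} [Finite E] [DecidableEq E] {M : Matroid E}
    {L : List (Finset E)} (hL : L.Nodup) (hM : ∀ F : Finset E, M.IsBase (F : Set E) ↔ F ∈ L)
    (hcard : ∀ F ∈ L, F.card = 2)
    (hmeet : ∀ j : Fin L.length, 0 < j.1 → ∃ G ∈ L.take j, ¬ Disjoint G L[j]) :
    IsShellingOrder (independenceComplex M) L := by
  refine ⟨hL, fun F => by rw [complexFacets_independenceComplex, hM], 1,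
    ⟨isComplex_independenceComplex M, fun F hF => ?_⟩, fun j hj hj0 => ?_⟩
  · rw [complexFacets_independenceComplex, hM] at hF
    rw [hcard F hF]; rfl
  · rw [sub_self]
    refine isPureOfDim_zero_of_edge (hcard _ (List.getElem_mem hj))
      (fun G hG => hcard G (List.mem_of_mem_take hG)) ?_ (hmeet ⟨j, hj⟩ hj0)
    intro h
    obtain ⟨i, hi, he⟩ := List.mem_take_iff_getElem.1 h
    have := (hL.getElem_inj_iff).1 he
    omega

/-- A shelling order of a complex of positive dimension cannot start with disjoint facets. -/
lemma not_isShellingOrder_of_disjoint {α : Type*} {Δ : Set (Finset α)} {F G : Finset α}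
    {L : List (Finset α)} (hG : 2 ≤ G.card) (hFG : Disjoint F G) :
    ¬ IsShellingOrder Δ (F :: G :: L) := by
  rintro ⟨-, hmem, d, hd, h⟩
  have h1 : IsPureOfDim (generatedComplex {A | A ∈ [F]} ∩ generatedComplex {G}) (d - 1) :=
    h 1 (by simp) one_pos
  have hGd := hd.2 G ((hmem G).1 (by simp))
  -- Disjointness makes the empty face the only facet of the intersection, so `d = 0`, whereas `G`
  -- gives `d ≥ 1`.
  have h2 := h1.2 ∅ ⟨⟨⟨F, by simp, by simp⟩, ⟨G, rfl, by simp⟩⟩, ?_⟩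
  · simp only [Finset.card_empty] at h2
    push_cast at h2
    omega
  · rintro S ⟨⟨A, hA, hSA⟩, ⟨C, rfl, hSC⟩⟩ -
    obtain rfl : A = F := by simpa using hA
    exact hFG hSA hSC

/-! ### Polytopes -/

/-- The line from `x` through `c` stays in the affine span, where `s` is a neighbourhood of `c`, so
it can be prolonged slightly beyond `c`. -/
lemma exists_add_smul_sub_mem_of_mem_intrinsicInterior {V : Type*} [AddCommGroup V] [Module ℝ V]
    [TopologicalSpace V] [IsTopologicalAddGroup V] [ContinuousSMul ℝ V] {s : Set V} {c x : V}
    (hc : c ∈ intrinsicInterior ℝ s) (hx : x ∈ s) : ∃ t : ℝ, 0 < t ∧ c + t • (c - x) ∈ s := by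
  obtain ⟨c', hc', rfl⟩ := mem_intrinsicInterior.1 hc
  have hmem : ∀ t : ℝ, (c' : V) + t • ((c' : V) - x) ∈ affineSpan ℝ s := fun t => by
    have := AffineMap.lineMap_mem (-t) c'.2 (subset_affineSpan ℝ s hx)
    rw [AffineMap.lineMap_apply_module'] at this
    convert this using 1
    module
  let f : ℝ → affineSpan ℝ s := fun t => ⟨(c' : V) + t • ((c' : V) - x), hmem t⟩
  have hf : Continuous f := by fun_prop
  have h0 : f 0 = c' := Subtype.ext (by simp [f])
  have hnhds : f ⁻¹' ((↑) ⁻¹' s) ∈ nhds (0 : ℝ) :=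
    hf.continuousAt (by rw [h0]; exact mem_interior_iff_mem_nhds.1 hc')
  obtain ⟨ε, hε, hball⟩ := Metric.mem_nhds_iff.1 hnhds
  exact ⟨ε / 2, by positivity, hball (by simp [abs_of_pos hε, hε])⟩

lemma convex_dualPolytope {E : Type*} [Fintype E] (P : Set (E → ℝ)) (c : E → ℝ) :
    Convex ℝ (dualPolytope P c) := by
  rintro x ⟨hx, hx'⟩ y ⟨hy, hy'⟩ a b ha hb hab
  refine ⟨Submodule.add_mem _ (Submodule.smul_mem _ a hx) (Submodule.smul_mem _ b hy),
    fun z hz => ?_⟩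
  rw [add_dotProduct, smul_dotProduct, smul_dotProduct, smul_eq_mul, smul_eq_mul]
  nlinarith [mul_le_mul_of_nonneg_left (hx' z hz) ha, mul_le_mul_of_nonneg_left (hy' z hz) hb]

lemma convex_dualFacet {E : Type*} [Fintype E] (P : Set (E → ℝ)) (c v : E → ℝ) :
    Convex ℝ (dualFacet P c v) := by
  rintro x ⟨hx, hx'⟩ y ⟨hy, hy'⟩ a b ha hb hab
  refine ⟨convex_dualPolytope P c hx hy ha hb hab, ?_⟩
  rw [add_dotProduct, smul_dotProduct, smul_dotProduct, hx', hy', smul_eq_mul, smul_eq_mul,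
    mul_one, mul_one, hab]

/-- If a midpoint of two points of the dual polytope lies in a facet, so do both points. -/
lemma mem_dualFacet_of_midpoint {E : Type*} [Fintype E] {P : Set (E → ℝ)} {c v x y : E → ℝ}
    (hv : v ∈ P) (hx : x ∈ dualPolytope P c) (hy : y ∈ dualPolytope P c)
    (h : (1 / 2 : ℝ) • x + (1 / 2 : ℝ) • y ∈ dualFacet P c v) :
    x ∈ dualFacet P c v ∧ y ∈ dualFacet P c v := by
  have h1 := h.2
  rw [add_dotProduct, smul_dotProduct, smul_dotProduct, smul_eq_mul, smul_eq_mul] at h1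
  have h2 := hx.2 v hv
  have h3 := hy.2 v hv
  exact ⟨⟨hx, by linarith⟩, ⟨hy, by linarith⟩⟩

lemma polyDim_of_nonempty {V : Type*} [AddCommGroup V] [Module ℝ V] {P : Set V}
    (hP : P.Nonempty) : polyDim P = Module.finrank ℝ (vectorSpan ℝ P) := if_pos hP

lemma polyDim_mono {V : Type*} [AddCommGroup V] [Module ℝ V] [FiniteDimensional ℝ V]
    {P Q : Set V} (hP : P.Nonempty) (hPQ : P ⊆ Q) : polyDim P ≤ polyDim Q := by
  rw [polyDim_of_nonempty hP, polyDim_of_nonempty (hP.mono hPQ)]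
  exact_mod_cast Submodule.finrank_mono (vectorSpan_mono ℝ hPQ)

lemma IsPolytopeShellingOfDim.lists {V : Type*} [AddCommGroup V] [Module ℝ V]
    [TopologicalSpace V] {n : ℕ} {P : Set V} {L : List (Set V)}
    (h : IsPolytopeShellingOfDim n P L) : ListsPolytopeFacets P L := by
  match n, h with
  | 0, h => exact h
  | 1, h => exact h
  | _ + 2, h => exact h.1

/-- In a shelling order of a polytope of dimension at least two, every point that the facet `L[j]`
shares with the previous facets lies in a facet of `L[j]` that is covered by them. -/
lemma IsPolytopeShelling.exists_facet {V : Type*} [AddCommGroup V] [Module ℝ V]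
    [TopologicalSpace V] {P : Set V} {L : List (Set V)} (h : IsPolytopeShelling P L)
    (hP : 2 ≤ polyDim P) {j : ℕ} (hj : j < L.length) (hj0 : 0 < j) {p : V} (hp : p ∈ L[j])
    (hp' : ∃ F ∈ L.take j, p ∈ F) :
    ∃ G, IsPolytopeFacet L[j] G ∧ p ∈ G ∧ ∀ y ∈ G, ∃ F ∈ L.take j, y ∈ F := by
  obtain ⟨n, hn⟩ : ∃ n, (polyDim P).toNat = n + 2 := ⟨(polyDim P).toNat - 2, by omega⟩
  rw [IsPolytopeShelling, hn] at h
  obtain ⟨G, hG, r, -, -, hr⟩ := h.2 j hj hj0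
  have hpU : p ∈ ⋃ F ∈ G.take r, F := hr ▸ ⟨hp, by simpa using hp'⟩
  simp only [Set.mem_iUnion, exists_prop] at hpU
  obtain ⟨A, hA, hpA⟩ := hpU
  refine ⟨A, (hG.lists.2 A).1 (List.mem_of_mem_take hA), hpA, fun y hy => ?_⟩
  have hyU : y ∈ L[j] ∩ ⋃ F ∈ L.take j, F := hr ▸ Set.mem_biUnion hA hy
  simpa using hyU.2

/-! ### The matroid -/

/-- The partition matroid of a map `f`, whose independent sets are those on which `f` is
injective. -/
def partitionMatroid {E ι : Type*} [DecidableEq E] [DecidableEq ι] (f : E → ι) : Matroid E :=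
  (IndepMatroid.ofFinset Set.univ (fun I : Finset E => Set.InjOn f I) (by simp)
    (fun _ _ hJ hIJ => hJ.mono (Finset.coe_subset.2 hIJ))
    (fun I J hI hJ hIJ => by
      have hlt : (I.image f).card < (J.image f).card := by
        rwa [Finset.card_image_of_injOn hI, Finset.card_image_of_injOn hJ]
      obtain ⟨a, ha, haI⟩ := Finset.exists_mem_notMem_of_card_lt_card hlt
      obtain ⟨e, he, rfl⟩ := Finset.mem_image.1 ha
      have heI : e ∉ I := fun h => haI (Finset.mem_image_of_mem f h)
      refine ⟨e, he, heI, ?_⟩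
      rw [Finset.coe_insert, Set.injOn_insert (by simpa using heI)]
      exact ⟨hI, by simpa using haI⟩)
    (fun _ _ => Set.subset_univ _)).matroid

lemma partitionMatroid_indep {E ι : Type*} [DecidableEq E] [DecidableEq ι] (f : E → ι)
    (I : Finset E) : (partitionMatroid f).Indep (I : Set E) ↔ Set.InjOn f I := by
  rw [partitionMatroid, IndepMatroid.matroid_Indep, IndepMatroid.ofFinset_indep]

/-- The direct sum of two copies of the uniform matroid of rank one on three elements. -/
def twoTriples : Matroid (Fin 6) := partitionMatroid (fun k : Fin 6 => decide (k < 3))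

/-- The bases of `twoTriples` in lexicographic order. -/
def twoTriplesLex : List (Finset (Fin 6)) :=
  [{0, 3}, {0, 4}, {0, 5}, {1, 3}, {1, 4}, {1, 5}, {2, 3}, {2, 4}, {2, 5}]

/-- The lexicographic order with two bases moved to the end. -/
def twoTriplesMoved : List (Finset (Fin 6)) :=
  [{0, 3}, {0, 4}, {0, 5}, {1, 3}, {1, 5}, {2, 3}, {2, 4}, {1, 4}, {2, 5}]

lemma twoTriples_isBase_iff_mem_lex (F : Finset (Fin 6)) :
    twoTriples.IsBase (F : Set (Fin 6)) ↔ F ∈ twoTriplesLex := by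
  have hind : ∀ I : Finset (Fin 6), I ∈ independenceComplex twoTriples ↔
      ∀ a ∈ I, ∀ b ∈ I, decide (a < 3) = decide (b < 3) → a = b := fun I =>
    (partitionMatroid_indep _ I).trans
      ⟨fun h a ha b hb => h ha hb, fun h a ha b hb => h a ha b hb⟩
  rw [← complexFacets_independenceComplex]
  constructor
  · rintro ⟨h1, h2⟩
    rw [hind] at h1
    -- Maximality is needed only against one-element extensions; this makes the claim a finite check
    -- over all `F`.
    have h3 : ∀ e, e ∉ F → ¬ ∀ a ∈ insert e F, ∀ b ∈ insert e F,
        decide (a < 3) = decide (b < 3) → a = b := fun e he h =>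
      he (h2 ((hind _).2 h) (Finset.subset_insert e F) (Finset.mem_insert_self e F))
    clear h2
    revert F
    decide +kernel
  · intro hF
    have hcard : F.card = 2 := by revert F; decide
    refine ⟨(hind F).2 (by revert F; decide), fun G hG hFG => ?_⟩
    replace hG := (hind G).1 hG
    refine (Finset.eq_of_subset_of_card_le hFG ?_).ge
    have hle : (G.image (fun k : Fin 6 => decide (k < 3))).card ≤ 2 := Finset.card_le_univ _
    rwa [Finset.card_image_of_injOn (fun a ha b hb => hG a ha b hb), ← hcard] at hle

lemma twoTriples_isBase_iff_mem_moved (F : Finset (Fin 6)) :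
    twoTriples.IsBase (F : Set (Fin 6)) ↔ F ∈ twoTriplesMoved := by
  rw [twoTriples_isBase_iff_mem_lex]
  have : twoTriplesMoved.Perm twoTriplesLex := by decide
  exact this.mem_iff.symm

lemma sort_pair {α : Type*} [LinearOrder α] {a b : α} (h : a < b) :
    ({a, b} : Finset α).sort = [a, b] := by
  rw [Finset.sort_insert _ (by simpa using h.le) (by simpa using h.ne), Finset.sort_singleton]

lemma isLexBasisList_twoTriplesLex : IsLexBasisList twoTriples twoTriplesLex := by
  refine ⟨fun B => (twoTriples_isBase_iff_mem_lex B).symm, ?_⟩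
  have hmap : twoTriplesLex.map (fun B => B.sort) =
      [[0, 3], [0, 4], [0, 5], [1, 3], [1, 4], [1, 5], [2, 3], [2, 4], [2, 5]] := by
    simp [twoTriplesLex, sort_pair]
  have hpair : (twoTriplesLex.map (fun B => B.sort)).Pairwise (· < ·) := by
    rw [hmap]
    decide
  exact List.pairwise_map.1 hpair

/-! ### The polytope of the matroid and its dual -/

lemma charVec_pair_mem {i j : Fin 6} (h : ({i, j} : Finset (Fin 6)) ∈ twoTriplesLex) :
    charVec {i, j} ∈ matroidPolytope twoTriples :=
  subset_convexHull ℝ _ ⟨_, (twoTriples_isBase_iff_mem_lex _).2 h, rfl⟩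

lemma charVec_apply {E : Type*} [DecidableEq E] (S : Finset E) (k : E) :
    charVec S k = if k ∈ S then 1 else 0 := by
  simp [charVec, Set.indicator_apply]

/-- The polytope of `twoTriples` lies in a product of two triangles. -/
lemma mem_matroidPolytope_twoTriples {x : Fin 6 → ℝ} (hx : x ∈ matroidPolytope twoTriples) :
    (∀ k, 0 ≤ x k) ∧ x 0 + x 1 + x 2 = 1 ∧ x 3 + x 4 + x 5 = 1 := by
  have hconv : Convex ℝ
      {x : Fin 6 → ℝ | (∀ k, 0 ≤ x k) ∧ x 0 + x 1 + x 2 = 1 ∧ x 3 + x 4 + x 5 = 1} := by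
    rintro x ⟨hx, hx1, hx2⟩ y ⟨hy, hy1, hy2⟩ a b ha hb hab
    refine ⟨fun k => add_nonneg (mul_nonneg ha (hx k)) (mul_nonneg hb (hy k)), ?_, ?_⟩ <;>
    simp only [Pi.add_apply, Pi.smul_apply, smul_eq_mul]
    · linear_combination a * hx1 + b * hy1 + hab
    · linear_combination a * hx2 + b * hy2 + hab
  refine convexHull_min ?_ hconv hx
  rintro _ ⟨B, hB, rfl⟩
  rw [twoTriples_isBase_iff_mem_lex] at hB
  refine ⟨fun k => by rw [charVec_apply]; split_ifs <;> norm_num, ?_⟩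
  simp only [twoTriplesLex, List.mem_cons, List.not_mem_nil, or_false] at hB
  rcases hB with rfl | rfl | rfl | rfl | rfl | rfl | rfl | rfl | rfl <;>
    simp [charVec_apply]

lemma mem_vectorSpan_twoTriples_iff {y : Fin 6 → ℝ} :
    y ∈ vectorSpan ℝ (matroidPolytope twoTriples) ↔ y 0 + y 1 + y 2 = 0 ∧ y 3 + y 4 + y 5 = 0 := by
  constructor
  · intro hy
    induction hy using Submodule.span_induction with
    | mem z hz =>
      obtain ⟨a, ha, b, hb, rfl⟩ := hz
      have ha' := (mem_matroidPolytope_twoTriples ha).2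
      have hb' := (mem_matroidPolytope_twoTriples hb).2
      simp only [vsub_eq_sub, Pi.sub_apply]
      constructor <;> linarith
    | zero => simp
    | add a b _ _ ha hb =>
      simp only [Pi.add_apply]
      constructor <;> linarith
    | smul t a _ ha =>
      simp only [Pi.smul_apply, smul_eq_mul]
      exact ⟨by linear_combination t * ha.1, by linear_combination t * ha.2⟩
  · rintro ⟨h1, h2⟩
    have hsub : ∀ {i j k l : Fin 6}, ({i, j} : Finset (Fin 6)) ∈ twoTriplesLex →
        ({k, l} : Finset (Fin 6)) ∈ twoTriplesLex →
        charVec {i, j} - charVec {k, l} ∈ vectorSpan ℝ (matroidPolytope twoTriples) :=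
      fun h h' => vsub_mem_vectorSpan ℝ (charVec_pair_mem h) (charVec_pair_mem h')
    -- These are the four edge directions of the product of triangles at the vertex `{0, 3}`; the
    -- sum conditions recover coordinates `0` and `3`.
    have key : y = y 1 • (charVec {1, 3} - charVec {0, 3}) +
        y 2 • (charVec {2, 3} - charVec {0, 3}) + y 4 • (charVec {0, 4} - charVec {0, 3}) +
        y 5 • (charVec {0, 5} - charVec {0, 3}) := by
      funext k
      simp only [Pi.add_apply, Pi.smul_apply, Pi.sub_apply, charVec_apply, smul_eq_mul]
      fin_cases k <;> simp <;> linarith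
    rw [key]
    refine add_mem (add_mem (add_mem ?_ ?_) ?_) ?_ <;>
    exact Submodule.smul_mem _ _ (hsub (by decide) (by decide))

/-- Moving from a vertex with `k`-th coordinate `1` slightly beyond `c` stays in the polytope, so `c
k + t * (c k - 1) ≥ 0` with `t > 0`. -/
lemma pos_of_mem_intrinsicInterior {c : Fin 6 → ℝ}
    (hc : c ∈ intrinsicInterior ℝ (matroidPolytope twoTriples)) (k : Fin 6) : 0 < c k := by
  obtain ⟨i, j, hmem, hk⟩ : ∃ i j : Fin 6,
      ({i, j} : Finset (Fin 6)) ∈ twoTriplesLex ∧ k ∈ ({i, j} : Finset (Fin 6)) := by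
    revert k; decide
  obtain ⟨t, ht, h⟩ :=
    exists_add_smul_sub_mem_of_mem_intrinsicInterior hc (charVec_pair_mem hmem)
  have h1 := (mem_matroidPolytope_twoTriples h).1 k
  simp only [Pi.add_apply, Pi.smul_apply, Pi.sub_apply, charVec_apply, if_pos hk,
    smul_eq_mul] at h1
  by_contra! h2
  nlinarith

/-- The vertex of the dual polytope of `twoTriples` that corresponds to the facet `x k = 0`. -/
noncomputable def dualVertex (c : Fin 6 → ℝ) (k : Fin 6) : Fin 6 → ℝ := fun i =>
  if (i < 3 ↔ k < 3) then (1 / 3 - if i = k then 1 else 0) / c k else 0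

/-- The `1 / 3` in `dualVertex` projects `-e_k / c k` to sum zero on the block of `k`. It is
constant on that block, where `x - c` sums to zero, so it does not affect the pairing. -/
lemma dualVertex_dotProduct {c x : Fin 6 → ℝ}
    (hc : c ∈ intrinsicInterior ℝ (matroidPolytope twoTriples))
    (hx : x ∈ matroidPolytope twoTriples) (k : Fin 6) :
    dotProduct (dualVertex c k) (x - c) = 1 - x k / c k := by
  have hk := (pos_of_mem_intrinsicInterior hc k).ne'
  obtain ⟨-, hc1, hc2⟩ := mem_matroidPolytope_twoTriples (intrinsicInterior_subset hc)
  obtain ⟨-, hx1, hx2⟩ := mem_matroidPolytope_twoTriples hx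
  have hx0 : x 0 = 1 - x 1 - x 2 := by linarith
  have hx3 : x 3 = 1 - x 4 - x 5 := by linarith
  have hc0 : c 0 = 1 - c 1 - c 2 := by linarith
  have hc3 : c 3 = 1 - c 4 - c 5 := by linarith
  have hsum : dotProduct (dualVertex c k) (x - c) * c k = c k - x k := by
    simp only [dotProduct, Fin.sum_univ_six, dualVertex, Pi.sub_apply]
    fin_cases k <;> simp at hk ⊢ <;> field_simp <;> linarith
  field_simp
  linarith

lemma dualVertex_mem_dualPolytope {c : Fin 6 → ℝ}
    (hc : c ∈ intrinsicInterior ℝ (matroidPolytope twoTriples)) (k : Fin 6) :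
    dualVertex c k ∈ dualPolytope (matroidPolytope twoTriples) c := by
  refine ⟨?_, fun x hx => ?_⟩
  · rw [mem_vectorSpan_twoTriples_iff]
    fin_cases k <;> simp [dualVertex] <;> ring
  · rw [dualVertex_dotProduct hc hx]
    have := div_nonneg ((mem_matroidPolytope_twoTriples hx).1 k)
      (pos_of_mem_intrinsicInterior hc k).le
    linarith

/-- The pairing is `1 - x k / c k` with `x = charVec B`, which equals `1` exactly when `x k = 0`. -/
lemma dualVertex_mem_dualFacet_iff {c : Fin 6 → ℝ}
    (hc : c ∈ intrinsicInterior ℝ (matroidPolytope twoTriples)) (k : Fin 6) {B : Finset (Fin 6)}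
    (hB : twoTriples.IsBase (B : Set (Fin 6))) :
    dualVertex c k ∈ dualFacet (matroidPolytope twoTriples) c (charVec B) ↔ k ∉ B := by
  have hk := (pos_of_mem_intrinsicInterior hc k).ne'
  rw [dualFacet, Set.mem_ofPred_eq, and_iff_right (dualVertex_mem_dualPolytope hc k),
    dualVertex_dotProduct hc (subset_convexHull ℝ _ ⟨B, hB, rfl⟩), charVec_apply]
  by_cases h : k ∈ B <;> simp [h, hk]

/-- The facet of the dual polytope that corresponds to the basis `{2, 4}` has dimension at least
three. -/
lemma three_le_polyDim_dualFacet {c : Fin 6 → ℝ}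
    (hc : c ∈ intrinsicInterior ℝ (matroidPolytope twoTriples)) :
    3 ≤ polyDim (dualFacet (matroidPolytope twoTriples) c (charVec {2, 4})) := by
  have hmem : ∀ k : Fin 6, k ∉ ({2, 4} : Finset (Fin 6)) →
      dualVertex c k ∈ dualFacet (matroidPolytope twoTriples) c (charVec {2, 4}) := fun k hk =>
    (dualVertex_mem_dualFacet_iff hc k ((twoTriples_isBase_iff_mem_lex _).2 (by decide))).2 hk
  have hpos := pos_of_mem_intrinsicInterior hc
  have hli : LinearIndependent ℝ ![dualVertex c 1 - dualVertex c 0,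
      dualVertex c 3 - dualVertex c 0, dualVertex c 5 - dualVertex c 0] := by
    rw [Fintype.linearIndependent_iff]
    intro g hg
    simp only [Fin.sum_univ_three, Matrix.cons_val_zero, Matrix.cons_val_one,
      Matrix.cons_val] at hg
    have e := fun i => congrFun hg i
    simp only [Pi.add_apply, Pi.smul_apply, Pi.sub_apply, smul_eq_mul, Pi.zero_apply,
      dualVertex] at e
    have e1 := e 1
    have e2 := e 2
    have e3 := e 3
    have e4 := e 4
    have e5 := e 5
    simp at e1 e2 e3 e4 e5
    have h0 : g 0 / c 1 = 0 := by linear_combination e2 - e1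
    have h1 : g 1 / c 3 = 0 := by linear_combination e4 - e3
    have h2 : g 2 / c 5 = 0 := by linear_combination e4 - e5
    intro i
    fin_cases i
    · simpa [(hpos 1).ne'] using h0
    · simpa [(hpos 3).ne'] using h1
    · simpa [(hpos 5).ne'] using h2
  rw [polyDim_of_nonempty ⟨_, hmem 0 (by decide)⟩]
  have hspan := Submodule.finrank_mono (Submodule.span_le.2 (Set.range_subset_iff.2
    (fun i => show ![dualVertex c 1 - dualVertex c 0, dualVertex c 3 - dualVertex c 0,
      dualVertex c 5 - dualVertex c 0] i ∈
        vectorSpan ℝ (dualFacet (matroidPolytope twoTriples) c (charVec {2, 4})) by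
      fin_cases i
      · exact vsub_mem_vectorSpan ℝ (hmem 1 (by decide)) (hmem 0 (by decide))
      · exact vsub_mem_vectorSpan ℝ (hmem 3 (by decide)) (hmem 0 (by decide))
      · exact vsub_mem_vectorSpan ℝ (hmem 5 (by decide)) (hmem 0 (by decide)))))
  rw [finrank_span_eq_card hli, Fintype.card_fin] at hspan
  exact_mod_cast hspan

/-- The facets of the dual polytope that correspond to the disjoint bases `{2, 4}` and `{1, 5}`
meet in a set of dimension at most one. -/
lemma polyDim_le_one_of_subset_inter {c : Fin 6 → ℝ}
    (hc : c ∈ intrinsicInterior ℝ (matroidPolytope twoTriples)) {G : Set (Fin 6 → ℝ)}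
    (hG : G ⊆ dualFacet (matroidPolytope twoTriples) c (charVec {2, 4}))
    (hG' : G ⊆ dualFacet (matroidPolytope twoTriples) c (charVec {1, 5})) : polyDim G ≤ 1 := by
  rcases G.eq_empty_or_nonempty with rfl | hne
  · simp [polyDim]
  have hpos := pos_of_mem_intrinsicInterior hc
  obtain ⟨-, hc1, hc2⟩ := mem_matroidPolytope_twoTriples (intrinsicInterior_subset hc)
  -- Since `χ₂₄ + χ₁₅ = χ₁₄ + χ₂₅`, the inequalities for `{1, 4}` and `{2, 5}` are also tight at
  -- `y`; comparing the equalities gives `y 1 = y 2` and `y 4 = y 5`.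
  have hcoord : ∀ y ∈ G, y 0 + y 1 + y 2 = 0 ∧ y 3 + y 4 + y 5 = 0 ∧ y 1 = y 2 ∧ y 4 = y 5 ∧
      y 1 + y 4 = 1 + dotProduct y c := by
    intro y hy
    obtain ⟨⟨hy1, hy2⟩, h24⟩ := hG hy
    obtain ⟨h0, h3⟩ := mem_vectorSpan_twoTriples_iff.1 hy1
    have h15 := (hG' hy).2
    have h14 := hy2 _ (charVec_pair_mem (i := 1) (j := 4) (by decide))
    have h25 := hy2 _ (charVec_pair_mem (i := 2) (j := 5) (by decide))
    rw [dotProduct_sub] at h24 h15 h14 h25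
    have hd : ∀ i j : Fin 6, i ≠ j → dotProduct y (charVec {i, j}) = y i + y j := by
      intro i j hij
      simp only [dotProduct, charVec_apply, mul_ite, mul_one, mul_zero]
      rw [Finset.sum_ite_mem, Finset.univ_inter, Finset.sum_pair hij]
    rw [hd _ _ (by decide)] at h24 h15 h14 h25
    refine ⟨h0, h3, ?_, ?_, ?_⟩ <;> linarith
  have hle : vectorSpan ℝ G ≤ Submodule.span ℝ {dualVertex c 0 - dualVertex c 3} := by
    refine Submodule.span_le.2 ?_
    rintro _ ⟨a, ha, b, hb, rfl⟩
    obtain ⟨a1, a2, a3, a4, a5⟩ := hcoord a ha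
    obtain ⟨b1, b2, b3, b4, b5⟩ := hcoord b hb
    have hrel : (a 1 - b 1) * c 0 + (a 4 - b 4) * c 3 = 0 := by
      simp only [dotProduct, Fin.sum_univ_six] at a5 b5
      rw [show a 0 = -2 * a 1 by linarith, show a 3 = -2 * a 4 by linarith, ← a3, ← a4] at a5
      rw [show b 0 = -2 * b 1 by linarith, show b 3 = -2 * b 4 by linarith, ← b3, ← b4] at b5
      linear_combination (a5 - b5) / 3 + (a 1 - b 1) / 3 * hc1 + (a 4 - b 4) / 3 * hc2
    -- The factor is read off at coordinate `1`, where `dualVertex c 0` equals `1 / (3 * c 0)` and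
    -- `dualVertex c 3` vanishes.
    refine Submodule.mem_span_singleton.2 ⟨3 * c 0 * (a 1 - b 1), ?_⟩
    have h0 := (hpos 0).ne'
    have h3 := (hpos 3).ne'
    have d3 : c 3 * (a 3 - b 3) = -2 * (c 3 * (a 4 - b 4)) := by
      rw [show a 3 = -2 * a 4 by linarith, show b 3 = -2 * b 4 by linarith]
      ring
    have d5 : c 3 * (a 5 - b 5) = c 3 * (a 4 - b 4) := by rw [a4, b4]
    funext k
    fin_cases k <;> simp [dualVertex] <;> field_simp <;> linarith
  rw [polyDim_of_nonempty hne]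
  exact_mod_cast (Submodule.finrank_mono hle).trans (finrank_span_le_card _)

lemma not_isPolytopeShelling_twoTriplesMoved {c : Fin 6 → ℝ}
    (hc : c ∈ intrinsicInterior ℝ (matroidPolytope twoTriples)) :
    ¬ IsPolytopeShelling (dualPolytope (matroidPolytope twoTriples) c)
      (inducedFacetOrder twoTriples c twoTriplesMoved) := by
  intro h
  have hbase : ∀ {B : Finset (Fin 6)}, B ∈ twoTriplesLex → twoTriples.IsBase (B : Set (Fin 6)) :=
    fun h => (twoTriples_isBase_iff_mem_lex _).2 h
  have hv : ∀ (k : Fin 6) {B : Finset (Fin 6)}, B ∈ twoTriplesLex → k ∉ B →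
      dualVertex c k ∈ dualFacet (matroidPolytope twoTriples) c (charVec B) := fun k B hB hk =>
    (dualVertex_mem_dualFacet_iff hc k (hbase hB)).2 hk
  have hdim := three_le_polyDim_dualFacet hc
  have hP : 2 ≤ polyDim (dualPolytope (matroidPolytope twoTriples) c) := by
    have := polyDim_mono ⟨_, hv 0 (B := {2, 4}) (by decide) (by decide)⟩
      (fun y (hy : y ∈ dualFacet (matroidPolytope twoTriples) c (charVec {2, 4})) => hy.1)
    omega
  set p := (1 / 2 : ℝ) • dualVertex c 0 + (1 / 2 : ℝ) • dualVertex c 3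
  have hpmem : ∀ {B : Finset (Fin 6)}, B ∈ twoTriplesLex → 0 ∉ B → 3 ∉ B →
      p ∈ dualFacet (matroidPolytope twoTriples) c (charVec B) := fun hB h0 h3 =>
    convex_dualFacet _ _ _ (hv 0 hB h0) (hv 3 hB h3) (by norm_num) (by norm_num) (by norm_num)
  have hp24 := hpmem (B := {2, 4}) (by decide) (by decide) (by decide)
  -- Position `6`, counted from `0`, is that of `{2, 4}`.
  obtain ⟨G, ⟨hexp, hGdim⟩, hpG, hcover⟩ := h.exists_facet hP (j := 6)
    (by simp [inducedFacetOrder, twoTriplesMoved]) (by decide)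
    (p := p) hp24 ⟨_, by simp [inducedFacetOrder, twoTriplesMoved],
      hpmem (B := {1, 5}) (by decide) (by decide) (by decide)⟩
  change IsExposed ℝ (dualFacet (matroidPolytope twoTriples) c (charVec {2, 4})) G at hexp
  change _ = polyDim (dualFacet (matroidPolytope twoTriples) c (charVec {2, 4})) at hGdim
  have hG15 : G ⊆ dualFacet (matroidPolytope twoTriples) c (charVec {1, 5}) := by
    intro y hy
    -- A priori different points of `G` may be covered by different facets. Testing the midpoint of
    -- `y` and `p` gives one earlier facet containing both, and containing `p` forces it to be that
    -- of `{1, 5}`.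
    obtain ⟨F, hF, hmF⟩ := hcover _ (hexp.convex (convex_dualFacet _ _ _) hy hpG
      (by norm_num : (0 : ℝ) ≤ 1 / 2) (by norm_num : (0 : ℝ) ≤ 1 / 2) (by norm_num))
    rw [inducedFacetOrder, ← List.map_take, List.mem_map] at hF
    obtain ⟨B, hB, rfl⟩ := hF
    have hBlex : B ∈ twoTriplesLex := by
      have := List.mem_of_mem_take hB
      rwa [← twoTriples_isBase_iff_mem_moved, twoTriples_isBase_iff_mem_lex] at this
    have hBP : charVec B ∈ matroidPolytope twoTriples :=
      subset_convexHull ℝ _ ⟨B, hbase hBlex, rfl⟩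
    obtain ⟨hyB, hpB⟩ := mem_dualFacet_of_midpoint hBP (hexp.subset hy).1 hp24.1 hmF
    obtain ⟨h0, h3⟩ := mem_dualFacet_of_midpoint hBP (dualVertex_mem_dualPolytope hc 0)
      (dualVertex_mem_dualPolytope hc 3) hpB
    rw [dualVertex_mem_dualFacet_iff hc _ (hbase hBlex)] at h0 h3
    have hB15 : B = {1, 5} := by
      clear hmF hBlex hBP hyB hpB
      revert B
      decide
    rwa [hB15] at hyB
  have := polyDim_le_one_of_subset_inter hc hexp.subset hG15
  omega

theorem mainTheorem4 :
    ∃ (n : ℕ) (M : Matroid (Fin n)) (K L : List (Finset (Fin n))) (B B' B'' : Finset (Fin n)),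
      M.E = Set.univ ∧
      -- three pairwise disjoint bases, the first of which is lexicographically smallest
      M.IsBase (B : Set (Fin n)) ∧ M.IsBase (B' : Set (Fin n)) ∧ M.IsBase (B'' : Set (Fin n)) ∧
      B ≠ B' ∧ B ≠ B'' ∧ B' ≠ B'' ∧
      Disjoint B B' ∧ Disjoint B B'' ∧ Disjoint B' B'' ∧
      -- `K` is the lexicographic shelling, and `L` arises from it by moving `B'`, `B''` to the end
      IsLexBasisList M K ∧ K.head? = some B ∧ IsShellingOrder (independenceComplex M) K ∧
      L = K.filter (fun C => C ≠ B' ∧ C ≠ B'') ++ [B', B''] ∧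
      -- `L` is a shelling order of `𝓘(M)` that is not reversible
      IsShellingOrder (independenceComplex M) L ∧
      ¬ IsShellingOrder (independenceComplex M) L.reverse ∧
      -- the induced facet order is not a shelling order of the dual matroid polytope
      ∀ c ∈ intrinsicInterior ℝ (matroidPolytope M),
        ¬ IsPolytopeShelling (dualPolytope (matroidPolytope M) c) (inducedFacetOrder M c L) := by
  have hcard : ∀ F ∈ twoTriplesLex, F.card = 2 := by decide
  have hcard' : ∀ F ∈ twoTriplesMoved, F.card = 2 := by decide
  refine ⟨6, twoTriples, twoTriplesLex, twoTriplesMoved, {0, 3}, {1, 4}, {2, 5}, rfl,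
    (twoTriples_isBase_iff_mem_lex _).2 (by decide),
    (twoTriples_isBase_iff_mem_lex _).2 (by decide),
    (twoTriples_isBase_iff_mem_lex _).2 (by decide),
    by decide, by decide, by decide, by decide, by decide, by decide,
    isLexBasisList_twoTriplesLex, rfl,
    isShellingOrder_of_card_two (by decide) twoTriples_isBase_iff_mem_lex hcard (by decide),
    by decide,
    isShellingOrder_of_card_two (by decide) twoTriples_isBase_iff_mem_moved hcard' (by decide),
    -- The reversed order starts with the disjoint bases `{2, 5}` and `{1, 4}`.
    not_isShellingOrder_of_disjoint (by decide) (by decide),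
    fun c hc => not_isPolytopeShelling_twoTriplesMoved hc⟩
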